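/- Let $\mathcal A$ be an abelian category, where "subcategory" means a full additive subcategory closed under isomorphisms, and let $\mathcal W\subseteq\mathcal X$ be subcategories of $\mathcal A$. Assume that $\mathcal X$ is closed under direct summands, extensions and kernels of epimorphisms, and that $\mathcal W$ is closed under direct summands and kernels of epimorphisms. Assume that $\mathcal W$ is an injective cogenerator and a projective generator for $\mathcal X$; that is, $\operatorname{Ext}^{n}_{\mathcal A}(X,W)=0=\operatorname{Ext}^{n}_{\mathcal A}(W,X)$ for all $n\ge 1$, $X\in\mathcal X$, $W\in\mathcal W$, and for each $X\in\mathcal X$ there are exact sequences $0\to X\to W\to X'\to 0$ and $0\to X''\to W'\to X\to 0$ with $W,W'\in\mathcal W$ and $X',X''\in\mathcal X$. For a subcategory $\mathcal U$ of $\mathcal A$, a $\mathcal U$-resolution of $M$ is an exact sequence $\cdots\to U_1\to U_0\to M\to 0$ with all $U_n\in\mathcal U$; it is proper if it stays exact under $\operatorname{Hom}_{\mathcal A}(U',-)$ for every $U'\in\mathcal U$. The $\mathcal U$-projective dimension $\mathcal U\text{-}\mathrm{pd}(M)\in\{0,1,2,\dots,\infty\}$ is the infimum of the lengths $\sup\{n\ge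 0: U_n\neq 0\}$ of the $\mathcal U$-resolutions of $M$ (with $\sup\emptyset=0$ and $\inf\emptyset=\infty$). If $U$ is a proper $\mathcal U$-resolution of $M$, then $\operatorname{Ext}^i_{\mathcal U\mathcal A}(M,-)=H^i(\operatorname{Hom}_{\mathcal A}(U,-))$ for $i\ge 0$. Let $M$ be an object of $\mathcal A$ with $d=\mathcal X\text{-}\mathrm{pd}(M)<\infty$. Then $M$ has a proper $\mathcal X$-resolution and a proper $\mathcal W$-resolution. For any proper $\mathcal X$-resolution $P$ and any proper $\mathcal W$-resolution $Q$ of $M$ there is a chain map $Q\to P$ lifting $\mathrm{id}_M$. For every such $P$, $Q$ and chain map, with $\vartheta^i:\operatorname{Ext}^i_{\mathcal X\mathcal A}(M,-)\to\operatorname{Ext}^i_{\mathcal W\mathcal A}(M,-)$ the induced natural transformation, the following conditions are equivalent: (i) $\mathcal W\text{-}\mathrm{pd}(M)<\infty$; (ii) $\vartheta^i$ is an isomorphism for every $i\ge 0$; (iii) $\vartheta^i$ and $\vartheta^{i+1}$ are isomorphisms for some $i$ with $1\le i$ and $i+1<d$, or $\vartheta^i$ is an isomorphism for a single $i$ with $i\ge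 1$ and $i\ge d$. -/

import Mathlib

open CategoryTheory CategoryTheory.Limits Opposite

universe v u

namespace RelHom

noncomputable section

section Subcategories

variable {C : Type u} [Category.{v} C] [Abelian C]

/-- `P` is (the class of objects of) a full additive subcategory closed under isomorphisms. -/
structure IsSubcategory (P : ObjectProperty C) : Prop where
  isoClosed : P.IsClosedUnderIsomorphisms
  zero : P.ContainsZero
  biprod : ∀ A B : C, P A → P B → P (A ⊞ B)

/-- Closure under direct summands: a direct summand of `B` is an object `A` with morphisms
`A ⟶ B ⟶ A` composing to the identity. -/
def ClosedUnderSummands (P : ObjectProperty C) : Prop :=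
  P.IsStableUnderRetracts

/-- An exact subcategory: closed under direct summands and extensions. -/
structure IsExactSubcategory (P : ObjectProperty C) : Prop where
  summands : ClosedUnderSummands P
  extensions : P.IsClosedUnderExtensions

/-- Closure under kernels of epimorphisms between objects of the subcategory. -/
def ClosedUnderKernelsOfEpis (P : ObjectProperty C) : Prop :=
  ∀ S : ShortComplex C, S.ShortExact → P S.X₂ → P S.X₃ → P S.X₁

/-- `P ⊥ Q`: the (Yoneda) groups `Ext^n(A, B)` vanish for all `A` in `P`, `B` in `Q`, `n ≥ 1`.
The `Ext` groups exist in every abelian category, in the universe `max u v`. -/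
def Perp (P Q : ObjectProperty C) : Prop :=
  letI : HasExt.{max u v} C := HasExt.standard C
  ∀ A B : C, P A → Q B → ∀ n : ℕ, 1 ≤ n → Subsingleton (Abelian.Ext.{max u v} A B n)

/-- Every `A` in `X` sits in a short exact sequence `0 ⟶ A ⟶ B ⟶ A' ⟶ 0`
with `B` in `W` and `A'` in `X`. -/
def IsCogeneratorFor (W X : ObjectProperty C) : Prop :=
  ∀ A : C, X A → ∃ (B A' : C) (i : A ⟶ B) (p : B ⟶ A') (w : i ≫ p = 0),
    (ShortComplex.mk i p w).ShortExact ∧ W B ∧ X A'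

/-- Every `A` in `X` sits in a short exact sequence `0 ⟶ A' ⟶ B ⟶ A ⟶ 0`
with `B` in `W` and `A'` in `X`. -/
def IsGeneratorFor (W X : ObjectProperty C) : Prop :=
  ∀ A : C, X A → ∃ (B A' : C) (i : A' ⟶ B) (p : B ⟶ A) (w : i ≫ p = 0),
    (ShortComplex.mk i p w).ShortExact ∧ W B ∧ X A'

structure IsInjectiveCogeneratorFor (W X : ObjectProperty C) : Prop where
  cogenerator : IsCogeneratorFor W X
  perp : Perp X W

structure IsProjectiveGeneratorFor (W X : ObjectProperty C) : Prop where
  generator : IsGeneratorFor W X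
  perp : Perp W X

end Subcategories

section Resolutions

variable {C : Type u} [Category.{v} C] [Abelian C]

/-- An `X`-resolution of `M`: a complex `⋯ ⟶ X₁ ⟶ X₀` of objects of `X` with an augmentation
`X₀ ⟶ M` such that the augmented complex `⋯ ⟶ X₁ ⟶ X₀ ⟶ M ⟶ 0` is exact. -/
structure Resolution (X : ObjectProperty C) (M : C) where
  complex : ChainComplex C ℕ
  mem : ∀ n, X (complex.X n)
  ε : complex.X 0 ⟶ M
  w : complex.d 1 0 ≫ ε = 0
  exact : (complex.augment ε w).Acyclic

/-- The augmented resolution. -/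
def Resolution.augmented {X : ObjectProperty C} {M : C} (R : Resolution X M) :
    ChainComplex C ℕ :=
  R.complex.augment R.ε R.w

/-- A resolution is proper if its augmented complex is `Hom(A, -)`-exact for all `A` in `X`. -/
def Resolution.IsProper {X : ObjectProperty C} {M : C} (R : Resolution X M) : Prop :=
  ∀ A : C, X A → (((preadditiveCoyoneda.obj (op A)).mapHomologicalComplex
    (ComplexShape.down ℕ)).obj R.augmented).Acyclic

/-- The length `sup {n ≥ 0 | Xₙ ≠ 0}` of a resolution (it is `0` for the zero complex). -/
def Resolution.length {X : ObjectProperty C} {M : C} (R : Resolution X M) : ℕ∞ :=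
  ⨆ (n : ℕ) (_ : ¬ IsZero (R.complex.X n)), (n : ℕ∞)

/-- The `X`-projective dimension: the infimum of the lengths of all `X`-resolutions;
it is `⊤` if there is none. -/
def projDim (X : ObjectProperty C) (M : C) : ℕ∞ :=
  ⨅ R : Resolution X M, R.length

/-- A morphism of complexes lifting the identity of the resolved object. -/
structure Lift {W X : ObjectProperty C} {M : C} (Q : Resolution W M) (P : Resolution X M) where
  hom : Q.complex ⟶ P.complex
  comm : hom.f 0 ≫ P.ε = Q.ε

end Resolutions

section RelativeExt

variable {C : Type u} [Category.{v} C] [Abelian C]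

/-- The complex of abelian groups `Hom(P, N)`, with `Hom(Pₙ, N)` in cohomological degree `n`,
as a functor of `N`. -/
def homComplex (P : ChainComplex C ℕ) :
    C ⥤ HomologicalComplex AddCommGrpCat.{v} (ComplexShape.down ℕ).symm where
  obj N := ((preadditiveYoneda.obj N).mapHomologicalComplex _).obj P.op
  map g := (NatTrans.mapHomologicalComplex (preadditiveYoneda.map g) _).app P.op

/-- Precomposition `Hom(P, -) ⟶ Hom(Q, -)` with a morphism of complexes `Q ⟶ P`. -/
def homComplexMap {Q P : ChainComplex C ℕ} (φ : Q ⟶ P) : homComplex P ⟶ homComplex Q where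
  app N := ((preadditiveYoneda.obj N).mapHomologicalComplex _).map
    ((HomologicalComplex.opFunctor C (ComplexShape.down ℕ)).map φ.op)
  naturality _ _ g :=
    ((NatTrans.mapHomologicalComplex (preadditiveYoneda.map g) _).naturality _).symm

/-- The relative cohomology functor `Ext_X^n(M, -)`, computed from a (proper) `X`-resolution
of `M`: the `n`th cohomology of `Hom(P, -)`. -/
def relExt {X : ObjectProperty C} {M : C} (P : Resolution X M) (n : ℕ) : C ⥤ AddCommGrpCat.{v} :=
  homComplex P.complex ⋙ HomologicalComplex.homologyFunctor _ _ n

/-- The comparison transformation `Ext_X^n(M, -) ⟶ Ext_W^n(M, -)`, induced by a lift of `id_M`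
from a (proper) `W`-resolution to a (proper) `X`-resolution. -/
def comparison {W X : ObjectProperty C} {M : C} {Q : Resolution W M} {P : Resolution X M}
    (φ : Lift Q P) (n : ℕ) : relExt P n ⟶ relExt Q n :=
  Functor.whiskerRight (homComplexMap φ.hom) (HomologicalComplex.homologyFunctor _ _ n)

end RelativeExt

end

end RelHom

/-!
By Auslander–Buchweitz approximation, an object `M` of finite `X`-projective dimension `d` has a
proper `X`-resolution `P'` of length at most `d` whose terms in positive degrees lie in `W`. Since
proper `X`-resolutions are unique up to homotopy, `P` may be replaced by `P'`. The mapping cone of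
`Q ⟶ P'` is exact, its term in degree `0` is `P'₀`, and its other terms lie in `W`.

If `ϑⁱ` is epi and `ϑⁱ⁺¹` is mono on every object (the latter is automatic for `i ≥ d`, where its
source vanishes), then `Hom(cone, N)` is exact at one spot for every `N`. Taking for `N` an object
of cycles of the cone shows that these cycles are a direct summand of a term of the cone, hence lie
in `W`. As `Ext¹(X, W) = 0`, the short exact sequences between the lower cycles split one after the
other, so `P'₀` lies in `W` and `P'` is a finite `W`-resolution.

Conversely, the syzygies of a finite `W`-resolution have finite `W`-projective dimension, so `Ext¹`
from `X` to them vanishes and `M` has a `W`-resolution that is proper even for `X`. Lifting the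
identity through it gives a homotopy inverse of `Q ⟶ P`.
-/

namespace RelativeHomology

open RelHom

variable {C : Type u} [Category.{v} C] [Abelian C]

section ShortExact

variable {S : ShortComplex C}

lemma shortExact_zero_id {Z : C} (hZ : IsZero Z) (A : C) :
    (ShortComplex.mk (0 : Z ⟶ A) (𝟙 A) zero_comp).ShortExact where
  exact := (ShortComplex.exact_iff_mono _ rfl).2 (inferInstanceAs (Mono (𝟙 A)))
  mono_f := hZ.mono _
  epi_g := inferInstanceAs (Epi (𝟙 A))

lemma exists_shortExact_of_isPushout (hS : S.ShortExact) {H E : C} {j : S.X₁ ⟶ H}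
    {c : S.X₂ ⟶ E} {a : H ⟶ E} (sq : IsPushout S.f j c a) :
    ∃ (q : E ⟶ S.X₃) (w : a ≫ q = 0), (ShortComplex.mk a q w).ShortExact := by
  have := hS.mono_f
  have := hS.epi_g
  obtain ⟨q, hq, w⟩ := sq.exists_desc S.g 0 (by simp)
  have : Epi (c ≫ q) := by rwa [hq]
  have : Epi q := epi_of_epi c q
  refine ⟨q, w,
    { exact := ShortComplex.exact_of_g_is_cokernel _
        (CokernelCofork.IsColimit.ofπ' _ _ fun k hk => ⟨hS.exact.desc (c ≫ k) ?_, ?_⟩)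
      mono_f := (MorphismProperty.monomorphisms C).of_isPushout sq.flip ‹Mono S.f›
      epi_g := inferInstance }⟩
  · rw [sq.w_assoc, hk, comp_zero]
  · refine sq.hom_ext ?_ ?_
    · rw [reassoc_of% hq, hS.exact.g_desc]
    · rw [reassoc_of% w, zero_comp, hk]

lemma shortExact_comp_of_isPushout (hS : S.ShortExact) {V E : C} {j : S.X₂ ⟶ V} [Mono j]
    {c : S.X₃ ⟶ E} {b : V ⟶ E} (sq : IsPushout S.g j c b) :
    ∃ w : (S.f ≫ j) ≫ b = 0, (ShortComplex.mk (S.f ≫ j) b w).ShortExact := by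
  have := hS.mono_f
  have := hS.epi_g
  have : Epi b := (MorphismProperty.epimorphisms C).of_isPushout sq.flip ‹Epi S.g›
  refine ⟨by rw [Category.assoc, ← sq.w, S.zero_assoc, zero_comp],
    { exact := ShortComplex.exact_of_g_is_cokernel _
        (CokernelCofork.IsColimit.ofπ' _ _ fun k hk =>
          ⟨sq.desc (hS.exact.desc (j ≫ k) (by simpa using hk)) k (hS.exact.g_desc _ _),
            sq.inr_desc _ _ _⟩)
      mono_f := mono_comp _ _
      epi_g := inferInstance }⟩

lemma exists_shortExact_of_isPullback (hS : S.ShortExact) {R E : C} {q : R ⟶ S.X₃}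
    {e : E ⟶ S.X₂} {b : E ⟶ R} (sq : IsPullback e b S.g q) :
    ∃ (i : S.X₁ ⟶ E) (w : i ≫ b = 0), (ShortComplex.mk i b w).ShortExact := by
  obtain ⟨i, w, h⟩ := exists_shortExact_of_isPushout hS.op sq.op.flip
  exact ⟨i.unop, Quiver.Hom.op_inj w, h.unop⟩

lemma shortExact_comp_of_isPullback (hS : S.ShortExact) {V E : C} {q : V ⟶ S.X₂} [Epi q]
    {e : E ⟶ S.X₁} {b : E ⟶ V} (sq : IsPullback e b S.f q) :
    ∃ w : b ≫ q ≫ S.g = 0, (ShortComplex.mk b (q ≫ S.g) w).ShortExact := by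
  have : Mono (X := S.op.X₂) q.op := inferInstanceAs (Mono q.op)
  obtain ⟨w, h⟩ := shortExact_comp_of_isPushout hS.op sq.op.flip
  exact ⟨Quiver.Hom.op_inj w, h.unop⟩

end ShortExact

section ResolutionDimension

/-- The objects `M` having an exact sequence `0 ⟶ Uₙ₋₁ ⟶ ⋯ ⟶ U₀ ⟶ M ⟶ 0` with all `Uᵢ` in `U`,
that is, those of `U`-projective dimension less than `n`. As in `HasProjectiveDimensionLT`, the
strict inequality makes the zero objects the base case of inductions. -/
def projDimLT (U : ObjectProperty C) : ℕ → ObjectProperty C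
  | 0 => fun M => IsZero M
  | n + 1 => fun M => ∃ (K R : C) (i : K ⟶ R) (p : R ⟶ M) (w : i ≫ p = 0),
      (ShortComplex.mk i p w).ShortExact ∧ U R ∧ projDimLT U n K

variable {U W X : ObjectProperty C} {n : ℕ} {M : C}

instance : (projDimLT U n).IsClosedUnderIsomorphisms where
  of_iso {M N} e hM := by
    cases n with
    | zero => exact IsZero.of_iso hM e.symm
    | succ n =>
      obtain ⟨K, R, i, p, w, hS, hR, hK⟩ := hM
      exact ⟨K, R, i, p ≫ e.hom, by simp [reassoc_of% w], ShortComplex.shortExact_of_iso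
        (ShortComplex.isoMk (S₁ := .mk i p w) (Iso.refl _) (Iso.refl _) e) hS, hR, hK⟩

lemma exists_shortExact_of_projDimLT [U.ContainsZero] [U.IsClosedUnderIsomorphisms]
    (hM : projDimLT U n M) :
    ∃ (K R : C) (i : K ⟶ R) (p : R ⟶ M) (w : i ≫ p = 0), (ShortComplex.mk i p w).ShortExact ∧
      (U R ∧ (n = 0 → IsZero R)) ∧ projDimLT U (n - 1) K := by
  cases n with
  | zero => exact ⟨M, M, 0, 𝟙 M, _, shortExact_zero_id hM M, ⟨U.prop_of_isZero hM, fun _ => hM⟩, hM⟩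
  | succ n =>
    obtain ⟨K, R, i, p, w, hS, hR, hK⟩ := hM
    exact ⟨K, R, i, p, w, hS, ⟨hR, by lia⟩, hK⟩

lemma projDimLT_succ [U.ContainsZero] [U.IsClosedUnderIsomorphisms] (hM : projDimLT U n M) :
    projDimLT U (n + 1) M := by
  induction n generalizing M with
  | zero => exact ⟨M, M, 0, 𝟙 M, _, shortExact_zero_id hM M, U.prop_of_isZero hM, hM⟩
  | succ n ih =>
    obtain ⟨K, R, i, p, w, hS, hR, hK⟩ := hM
    exact ⟨K, R, i, p, w, hS, hR, ih hK⟩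

lemma projDimLT_X₂_of_shortExact [X.IsClosedUnderExtensions] {S : ShortComplex C}
    (hS : S.ShortExact) (h₁ : X S.X₁) (h₃ : projDimLT X (n + 1) S.X₃) :
    projDimLT X (n + 1) S.X₂ := by
  obtain ⟨K, R, j, q, w, hR, hXR, hK⟩ := h₃
  have sq := IsPullback.of_hasPullback S.g q
  obtain ⟨i, _, hi⟩ := exists_shortExact_of_isPullback hS sq
  obtain ⟨c, _, hc⟩ := exists_shortExact_of_isPullback hR sq.flip
  exact ⟨K, _, c, _, _, hc, X.prop_X₂_of_shortExact hi h₁ hXR, hK⟩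

lemma exists_shortExact_pushout [X.IsClosedUnderExtensions] {S : ShortComplex C}
    (hS : S.ShortExact) (hX : X S.X₂) {H Y : C} {j : S.X₁ ⟶ H} {q : H ⟶ Y} {w : j ≫ q = 0}
    (hj : (ShortComplex.mk j q w).ShortExact) (hY : X Y) :
    ∃ (E : C) (a : H ⟶ E) (b : E ⟶ S.X₃) (w : a ≫ b = 0),
      (ShortComplex.mk a b w).ShortExact ∧ X E := by
  have sq := IsPushout.of_hasPushout S.f j
  obtain ⟨b, _, hb⟩ := exists_shortExact_of_isPushout hS sq
  obtain ⟨e, _, he⟩ := exists_shortExact_of_isPushout hj sq.flip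
  exact ⟨_, _, b, _, hb, X.prop_X₂_of_shortExact he hX hY⟩

lemma exists_hull_of_projDimLT [X.ContainsZero] [X.IsClosedUnderIsomorphisms]
    [X.IsClosedUnderExtensions] (hW : IsCogeneratorFor W X) (hM : projDimLT X n M) :
    ∃ (H Y : C) (i : M ⟶ H) (p : H ⟶ Y) (w : i ≫ p = 0),
      (ShortComplex.mk i p w).ShortExact ∧ projDimLT W n H ∧ X Y := by
  induction n generalizing M with
  | zero => exact ⟨M, M, 0, 𝟙 M, _, shortExact_zero_id hM M, hM, X.prop_of_isZero hM⟩
  | succ n ih =>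
    obtain ⟨K, R, i, p, w, hR, hXR, hK⟩ := hM
    obtain ⟨H, Y, j, q, _, hH, hWH, hY⟩ := ih hK
    obtain ⟨A, a, b, _, hA, hXA⟩ := exists_shortExact_pushout hR hXR hH hY
    obtain ⟨B, A', k, r, _, hB, hWB, hXA'⟩ := hW A hXA
    have := hB.mono_f
    have sq := IsPushout.of_hasPushout b k
    obtain ⟨_, hE⟩ := shortExact_comp_of_isPushout hA sq
    obtain ⟨e, _, he⟩ := exists_shortExact_of_isPushout hB sq.flip
    exact ⟨_, A', _, e, _, he, ⟨H, B, _, _, _, hE, hWB, hWH⟩, hXA'⟩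

lemma exists_approximation_of_projDimLT [X.ContainsZero] [X.IsClosedUnderIsomorphisms]
    [X.IsClosedUnderExtensions] (hW : IsCogeneratorFor W X) (hM : projDimLT X (n + 1) M) :
    ∃ (K A : C) (i : K ⟶ A) (p : A ⟶ M) (w : i ≫ p = 0),
      (ShortComplex.mk i p w).ShortExact ∧ X A ∧ projDimLT W n K := by
  obtain ⟨K, R, i, p, w, hR, hXR, hK⟩ := hM
  obtain ⟨H, Y, j, q, _, hH, hWH, hY⟩ := exists_hull_of_projDimLT hW hK
  obtain ⟨A, a, b, _, hA, hXA⟩ := exists_shortExact_pushout hR hXR hH hY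
  exact ⟨H, A, a, b, _, hA, hXA, hWH⟩

lemma exists_cover_of_projDimLT [X.ContainsZero] [X.IsClosedUnderIsomorphisms]
    [X.IsClosedUnderExtensions] (hW : IsGeneratorFor W X) (hM : projDimLT X (n + 1) M) :
    ∃ (L B : C) (i : L ⟶ B) (p : B ⟶ M) (w : i ≫ p = 0),
      (ShortComplex.mk i p w).ShortExact ∧ W B ∧ projDimLT X (n + 1) L := by
  obtain ⟨K, R, i, p, _, hR, hXR, hK⟩ := hM
  obtain ⟨B, A', j, q, _, hB, hWB, hXA'⟩ := hW R hXR
  have := hB.epi_g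
  have sq := IsPullback.of_hasPullback i q
  obtain ⟨_, hL⟩ := shortExact_comp_of_isPullback hR sq
  obtain ⟨c, _, hc⟩ := exists_shortExact_of_isPullback hB sq.flip
  exact ⟨_, B, _, _, _, hL, hWB, projDimLT_X₂_of_shortExact hc hXA' (projDimLT_succ hK)⟩

end ResolutionDimension

section Perpendicularity

variable {P Q : ObjectProperty C}

lemma perp_projDimLT (h : Perp P Q) (n : ℕ) : Perp P (projDimLT Q n) := by
  let _ : HasExt.{max u v} C := HasExt.standard C
  induction n with
  | zero =>
    intro A B _ hB m _
    have hB : IsZero B := hB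
    refine subsingleton_of_forall_eq 0 fun x => ?_
    rw [← x.comp_mk₀_id, hB.eq_of_src (𝟙 B) 0, Abelian.Ext.mk₀_zero, Abelian.Ext.comp_zero]
  | succ n ih =>
    rintro A B hA ⟨K, R, i, p, w, hS, hR, hK⟩ m hm
    refine subsingleton_of_forall_eq 0 fun x => ?_
    have : Subsingleton (Abelian.Ext A K (m + 1)) := ih A K hA hK (m + 1) (by lia)
    have : Subsingleton (Abelian.Ext A R m) := h A R hA hR m hm
    obtain ⟨y, rfl⟩ := Abelian.Ext.covariant_sequence_exact₃ A hS x rfl (Subsingleton.elim _ _)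
    rw [Subsingleton.elim y 0, Abelian.Ext.zero_comp]

lemma exists_lift_of_perp (h : Perp P Q) {S : ShortComplex C} (hS : S.ShortExact) (hQ : Q S.X₁)
    {A : C} (hA : P A) (f : A ⟶ S.X₃) : ∃ g : A ⟶ S.X₂, g ≫ S.g = f := by
  let _ : HasExt.{max u v} C := HasExt.standard C
  have : Subsingleton (Abelian.Ext A S.X₁ 1) := h A S.X₁ hA hQ 1 le_rfl
  obtain ⟨y, hy⟩ := Abelian.Ext.covariant_sequence_exact₃ A hS (Abelian.Ext.mk₀ f) rfl
    (Subsingleton.elim _ _)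
  obtain ⟨g, rfl⟩ := (Abelian.Ext.mk₀_bijective _ _).2 y
  refine ⟨g, (Abelian.Ext.mk₀_bijective _ _).1 ?_⟩
  rw [← hy, Abelian.Ext.mk₀_comp_mk₀]

end Perpendicularity

section AcyclicComplexes

variable {E : ChainComplex C ℕ}

lemma acyclic_iff : E.Acyclic ↔ Epi (E.d 1 0) ∧
    ∀ n : ℕ, (ShortComplex.mk (E.d (n + 2) (n + 1)) (E.d (n + 1) n) (by simp)).Exact := by
  have h₀ : E.ExactAt 0 ↔ Epi (E.d 1 0) := by
    rw [E.exactAt_iff' 1 0 0 (by simp) (by simp)]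
    exact ShortComplex.exact_iff_epi _ (E.shape 0 0 (by simp))
  have hs (n : ℕ) : E.ExactAt (n + 1) ↔
      (ShortComplex.mk (E.d (n + 2) (n + 1)) (E.d (n + 1) n) (by simp)).Exact :=
    E.exactAt_iff' (n + 2) (n + 1) n (by simp) (by simp)
  refine ⟨fun h => ⟨h₀.1 (h 0), fun n => (hs n).1 (h (n + 1))⟩, fun h n => ?_⟩
  cases n with
  | zero => exact h₀.2 h.1
  | succ n => exact (hs n).2 (h.2 n)

/-- The complex `Hom(A, E)` is exact. -/
def HomAcyclic (A : C) (E : ChainComplex C ℕ) : Prop :=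
  (((preadditiveCoyoneda.obj (op A)).mapHomologicalComplex (ComplexShape.down ℕ)).obj E).Acyclic

lemma homAcyclic_iff {A : C} : HomAcyclic A E ↔
    (∀ f : A ⟶ E.X 0, ∃ g : A ⟶ E.X 1, g ≫ E.d 1 0 = f) ∧
      ∀ (n : ℕ) (f : A ⟶ E.X (n + 1)), f ≫ E.d (n + 1) n = 0 →
        ∃ g : A ⟶ E.X (n + 2), g ≫ E.d (n + 2) (n + 1) = f := by
  rw [HomAcyclic, acyclic_iff, AddCommGrpCat.epi_iff_surjective]
  exact and_congr Iff.rfl (forall_congr' fun n => ShortComplex.ab_exact_iff _)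

variable (E) in
/-- In degree `0` every element is a cycle. -/
noncomputable def cyclesZeroIso : E.cycles 0 ≅ E.X 0 :=
  have : IsIso (E.iCycles 0) := E.isIso_iCycles 0 _ rfl (by simp)
  asIso (E.iCycles 0)

lemma shortExact_cycles (hE : E.Acyclic) (n : ℕ) :
    (ShortComplex.mk (E.iCycles (n + 1)) (E.toCycles (n + 1) n)
      (by rw [← cancel_mono (E.iCycles n)]; simp)).ShortExact where
  exact := ShortComplex.exact_of_f_is_kernel _
    (KernelFork.IsLimit.ofι' _ _ fun k hk => ⟨E.liftCycles k n (by simp) (by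
      rw [← E.toCycles_i, reassoc_of% hk, zero_comp]), E.liftCycles_i _ _ _ _⟩)
  mono_f := inferInstance
  epi_g := Preadditive.epi_of_isZero_cokernel' _ (E.homologyIsCokernel (n + 1) n (by simp))
    (hE n).isZero_homology

lemma projDimLT_cycles (hE : E.Acyclic) {U : ObjectProperty C} (hU : ∀ n, U (E.X (n + 1)))
    (j k : ℕ) (hz : IsZero (E.X (j + k + 1))) : projDimLT U k (E.cycles j) := by
  induction k generalizing j with
  | zero =>
    have := (shortExact_cycles hE j).epi_g
    exact hz.of_epi (E.toCycles (j + 1) j)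
  | succ k ih =>
    exact ⟨_, _, _, _, _, shortExact_cycles hE j, hU j, ih (j + 1) (by convert hz using 2; lia)⟩

end AcyclicComplexes

section Resolutions

variable {U V : ObjectProperty C} {M : C}

/-- The augmented resolution is `Hom(A, -)`-exact for all `A` in `V`. A `U`-resolution is proper in
the usual sense, `R.IsProper`, if it is proper for `U`. -/
def IsProperFor (V : ObjectProperty C) (R : Resolution U M) : Prop :=
  ∀ A, V A → HomAcyclic A R.augmented

lemma length_le_iff (R : Resolution U M) (n : ℕ) :
    R.length ≤ n ↔ ∀ k, n < k → IsZero (R.complex.X k) := by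
  simp only [Resolution.length, iSup_le_iff, Nat.cast_le]
  exact forall_congr' fun k => by rw [not_imp_comm, not_le]

lemma projDimLT_of_projDim_le {n : ℕ} (h : projDim U M ≤ n) : projDimLT U (n + 1) M := by
  have : Nonempty (Resolution U M) := by
    by_contra! hM
    rw [projDim, iInf_of_empty] at h
    exact ENat.natCast_ne_top n (top_le_iff.1 h)
  obtain ⟨R, hR⟩ := ENat.exists_eq_iInf fun R : Resolution U M => R.length
  have hz := (length_le_iff R n).1 (hR.le.trans h) (n + 1) (by lia)
  have h0 : projDimLT U (n + 1) (R.augmented.cycles 0) :=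
    projDimLT_cycles R.exact (fun n => R.mem n) 0 (n + 1) (by rw [zero_add]; exact hz)
  exact (projDimLT U (n + 1)).prop_of_iso (cyclesZeroIso R.augmented) h0

lemma projDim_lt_top (R : Resolution U M) {n : ℕ} (h : R.length ≤ n) : projDim U M < ⊤ :=
  (iInf_le _ R).trans_lt (h.trans_lt (ENat.natCast_lt_top n))

end Resolutions

section Splicing

variable {K R : ℕ → C} {i : ∀ n, K (n + 1) ⟶ R n} {p : ∀ n, R n ⟶ K n} (w : ∀ n, i n ≫ p n = 0)

/-- The complex `⋯ ⟶ R₁ ⟶ R₀` obtained by splicing the sequences `0 ⟶ Kₙ₊₁ ⟶ Rₙ ⟶ Kₙ ⟶ 0`;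
it is augmented by `R₀ ⟶ K₀`. -/
noncomputable def spliced : ChainComplex C ℕ :=
  ChainComplex.of R (fun n => p (n + 1) ≫ i n) fun n => by
    rw [Category.assoc, reassoc_of% w (n + 1), zero_comp, comp_zero]

lemma spliced_d (n : ℕ) : (spliced w).d (n + 1) n = p (n + 1) ≫ i n :=
  ChainComplex.of_d R (fun n => p (n + 1) ≫ i n) n

lemma spliced_d_comp : (spliced w).d 1 0 ≫ p 0 = 0 := by
  rw [spliced_d]
  exact (Category.assoc _ _ _).trans ((congrArg (p 1 ≫ ·) (w 0)).trans comp_zero)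

variable {w} (h : ∀ n, (ShortComplex.mk (i n) (p n) (w n)).ShortExact)
include h

lemma exists_comp_eq_of_comp_d_eq_zero {A : C} {n : ℕ} (f : A ⟶ R n)
    (hf : f ≫ ((spliced w).augment (p 0) (spliced_d_comp w)).d (n + 1) n = 0) :
    ∃ g, g ≫ i n = f := by
  have := (h n).mono_f
  refine ⟨(h n).exact.lift f ?_, (h n).exact.lift_f f _⟩
  cases n with
  | zero => exact hf
  | succ n =>
    have := (h n).mono_f
    rwa [← cancel_mono (i n), zero_comp, Category.assoc, ← spliced_d w n]

lemma acyclic_augment_spliced : ((spliced w).augment (p 0) (spliced_d_comp w)).Acyclic := by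
  refine acyclic_iff.2 ⟨(h 0).epi_g, fun n => ?_⟩
  rw [ShortComplex.exact_iff_exact_up_to_refinements]
  intro A f hf
  obtain ⟨g, rfl⟩ := exists_comp_eq_of_comp_d_eq_zero h f hf
  have := (h (n + 1)).epi_g
  obtain ⟨A', π, hπ, x, hx⟩ := surjective_up_to_refinements_of_epi (p (n + 1)) g
  refine ⟨A', π, hπ, x, ?_⟩
  change π ≫ g ≫ i n = x ≫ (spliced w).d (n + 1) n
  rw [spliced_d]
  exact (reassoc_of% hx) (i n)

lemma homAcyclic_augment_spliced {A : C} (hA : ∀ n (f : A ⟶ K n), ∃ g, g ≫ p n = f) :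
    HomAcyclic A ((spliced w).augment (p 0) (spliced_d_comp w)) := by
  refine homAcyclic_iff.2 ⟨hA 0, fun n f hf => ?_⟩
  obtain ⟨g, rfl⟩ := exists_comp_eq_of_comp_d_eq_zero h f hf
  obtain ⟨x, rfl⟩ := hA (n + 1) g
  exact ⟨x, (congrArg (x ≫ ·) (spliced_d w n)).trans (Category.assoc _ _ _).symm⟩

end Splicing

/-- `S n` is the class of the `n`th syzygy and `T n` that of the `n`th term. -/
lemma exists_resolution {U V : ObjectProperty C} (S T : ℕ → ObjectProperty C) (hT : ∀ n, T n ≤ U)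
    (hV : ∀ n, Perp V (S (n + 1)))
    (step : ∀ n K, S n K → ∃ (L R : C) (i : L ⟶ R) (p : R ⟶ K) (w : i ≫ p = 0),
      (ShortComplex.mk i p w).ShortExact ∧ T n R ∧ S (n + 1) L) {M : C} (hM : S 0 M) :
    ∃ R : Resolution U M, (∀ n, T n (R.complex.X n)) ∧ IsProperFor V R := by
  choose L R i p w hS hR hL using step
  let syzygy : ∀ n, { K // S n K } :=
    fun n => Nat.rec ⟨M, hM⟩ (fun n K => ⟨L n K.1 K.2, hL n K.1 K.2⟩) n
  let K n := (syzygy n).1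
  have h n : (ShortComplex.mk (X₁ := K (n + 1)) (i n (K n) (syzygy n).2) _ (w n _ _)).ShortExact :=
    hS n (K n) (syzygy n).2
  exact ⟨⟨_, fun n => hT n _ (hR n _ _), _, _,
      acyclic_augment_spliced (p := fun n => p n (K n) _) h⟩,
    fun n => hR n _ _, fun A hA => homAcyclic_augment_spliced (p := fun n => p n (K n) _) h
      fun n => exists_lift_of_perp (hV n) (h n) (syzygy (n + 1)).2 hA⟩

section Lifts

variable {W X Y : ObjectProperty C} {M : C}

section

variable {Q : Resolution W M} {P : Resolution X M} (hP : IsProperFor W P)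
include hP

lemma exists_comp_ε_eq (n : ℕ) (f : Q.complex.X n ⟶ M) :
    ∃ g : Q.complex.X n ⟶ P.complex.X 0, g ≫ P.ε = f :=
  (homAcyclic_iff.1 (hP _ (Q.mem n))).1 f

lemma exists_comp_d_one_eq (n : ℕ) (f : Q.complex.X n ⟶ P.complex.X 0) (hf : f ≫ P.ε = 0) :
    ∃ g : Q.complex.X n ⟶ P.complex.X 1, g ≫ P.complex.d 1 0 = f :=
  (homAcyclic_iff.1 (hP _ (Q.mem n))).2 0 f hf

lemma exists_comp_d_eq (n k : ℕ) (f : Q.complex.X n ⟶ P.complex.X (k + 1))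
    (hf : f ≫ P.complex.d (k + 1) k = 0) :
    ∃ g : Q.complex.X n ⟶ P.complex.X (k + 2), g ≫ P.complex.d (k + 2) (k + 1) = f :=
  (homAcyclic_iff.1 (hP _ (Q.mem n))).2 (k + 1) f hf

variable (Q) in
lemma nonempty_lift : Nonempty (Lift Q P) := by
  obtain ⟨f₀, h₀⟩ := exists_comp_ε_eq hP 0 Q.ε
  obtain ⟨f₁, h₁⟩ := exists_comp_d_one_eq hP 1 (Q.complex.d 1 0 ≫ f₀)
    (by rw [Category.assoc, h₀, Q.w])
  have step (n : ℕ) (g : Q.complex.X n ⟶ P.complex.X n)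
      (g' : Q.complex.X (n + 1) ⟶ P.complex.X (n + 1))
      (w : g' ≫ P.complex.d (n + 1) n = Q.complex.d (n + 1) n ≫ g) :
      ∃ g'' : Q.complex.X (n + 2) ⟶ P.complex.X (n + 2),
        g'' ≫ P.complex.d (n + 2) (n + 1) = Q.complex.d (n + 2) (n + 1) ≫ g' :=
    exists_comp_d_eq hP (n + 2) n _
      (by rw [Category.assoc, w, HomologicalComplex.d_comp_d_assoc, zero_comp])
  choose next hnext using step
  exact ⟨⟨ChainComplex.mkHom _ _ f₀ f₁ h₁ fun n w => ⟨next n w.1 w.2.1 w.2.2, hnext n _ _ _⟩, h₀⟩⟩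

lemma nonempty_homotopy_zero (f : Q.complex ⟶ P.complex) (hf : f.f 0 ≫ P.ε = 0) :
    Nonempty (Homotopy f 0) := by
  obtain ⟨s₀, h₀⟩ := exists_comp_d_one_eq hP 0 (f.f 0) hf
  obtain ⟨s₁, h₁⟩ := exists_comp_d_eq hP 1 0 (f.f 1 - Q.complex.d 1 0 ≫ s₀)
    (by rw [Preadditive.sub_comp, Category.assoc, h₀, f.comm, sub_self])
  have step (n : ℕ) (g : Q.complex.X n ⟶ P.complex.X (n + 1))
      (g' : Q.complex.X (n + 1) ⟶ P.complex.X (n + 2))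
      (w : f.f (n + 1) = Q.complex.d (n + 1) n ≫ g + g' ≫ P.complex.d (n + 2) (n + 1)) :
      ∃ g'' : Q.complex.X (n + 2) ⟶ P.complex.X (n + 3),
        g'' ≫ P.complex.d (n + 3) (n + 2) = f.f (n + 2) - Q.complex.d (n + 2) (n + 1) ≫ g' :=
    exists_comp_d_eq hP (n + 2) (n + 1) _ (by
      rw [Preadditive.sub_comp, Category.assoc, f.comm, w, Preadditive.comp_add,
        HomologicalComplex.d_comp_d_assoc, zero_comp, zero_add, sub_self])
  choose next hnext using step
  exact ⟨Homotopy.mkInductive _ s₀ h₀.symm s₁ (by rw [h₁]; abel) fun n w =>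
    ⟨next n w.1 w.2.1 w.2.2, by rw [hnext]; abel⟩⟩

lemma comparison_eq (φ ψ : Lift Q P) (n : ℕ) : comparison φ n = comparison ψ n := by
  obtain ⟨H⟩ := nonempty_homotopy_zero hP (φ.hom - ψ.hom) (by
    rw [HomologicalComplex.sub_f_apply, Preadditive.sub_comp, φ.comm, ψ.comm, sub_self])
  ext N : 2
  exact ((preadditiveYoneda.obj N).mapHomotopy
    (Homotopy.equivSubZero.symm H).op).homologyMap_eq n

end

/-- The composition of lifts of the identity, to compare two resolutions through a third. -/
def compLift {R : Resolution Y M} {Q : Resolution W M} {P : Resolution X M}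
    (ψ : Lift R Q) (φ : Lift Q P) : Lift R P :=
  ⟨ψ.hom ≫ φ.hom, by rw [HomologicalComplex.comp_f, Category.assoc, φ.comm, ψ.comm]⟩

lemma comparison_comp {R : Resolution Y M} {Q : Resolution W M} {P : Resolution X M}
    (ψ : Lift R Q) (φ : Lift Q P) (n : ℕ) :
    comparison (compLift ψ φ) n = comparison φ n ≫ comparison ψ n := by
  have h : homComplexMap (ψ.hom ≫ φ.hom) = homComplexMap φ.hom ≫ homComplexMap ψ.hom := by
    ext N k f
    exact Category.assoc (obj := C) _ _ f
  rw [comparison, compLift, h, Functor.whiskerRight_comp]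
  rfl

lemma comparison_eq_id {P : Resolution X M} (hP : IsProperFor X P) (φ : Lift P P) (n : ℕ) :
    comparison φ n = 𝟙 _ := by
  have h : homComplexMap (𝟙 P.complex) = 𝟙 _ := by
    ext N k f
    exact Category.id_comp (obj := C) f
  rw [comparison_eq hP φ ⟨𝟙 _, Category.id_comp _⟩ n, comparison, h]
  exact Functor.whiskerRight_id _

lemma isIso_comparison {Q : Resolution W M} {P : Resolution X M} (hQ : IsProperFor W Q)
    (hP : IsProperFor X P) (φ : Lift Q P) (ψ : Lift P Q) (n : ℕ) : IsIso (comparison φ n) :=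
  ⟨comparison ψ n, by rw [← comparison_comp, comparison_eq_id hP],
    by rw [← comparison_comp, comparison_eq_id hQ]⟩

end Lifts

section SpecialResolutions

variable {W X : ObjectProperty C} {n : ℕ} {M : C}

lemma exists_isProperFor_of_projDimLT [W.ContainsZero] [W.IsClosedUnderIsomorphisms]
    (hXW : Perp X W) (hM : projDimLT W n M) : ∃ R : Resolution W M, IsProperFor X R := by
  obtain ⟨R, -, hR⟩ := exists_resolution (fun k => projDimLT W (n - k)) (fun _ => W)
    (fun _ => le_rfl) (fun k => perp_projDimLT hXW (n - (k + 1))) (fun k K hK => by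
      obtain ⟨L, R, i, p, w, hS, ⟨hR, -⟩, hL⟩ := exists_shortExact_of_projDimLT hK
      exact ⟨L, R, i, p, w, hS, hR, hL⟩) hM
  exact ⟨R, hR⟩

variable [X.ContainsZero] [X.IsClosedUnderIsomorphisms] [X.IsClosedUnderExtensions]

lemma exists_isProper_of_isProjectiveGeneratorFor (hW : IsProjectiveGeneratorFor W X)
    (hM : projDimLT X (n + 1) M) : ∃ R : Resolution W M, R.IsProper := by
  obtain ⟨R, -, hR⟩ := exists_resolution (fun _ => projDimLT X (n + 1)) (fun _ => W)
    (fun _ => le_rfl) (fun _ => perp_projDimLT hW.perp (n + 1))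
    (fun _ _ => exists_cover_of_projDimLT hW.generator) hM
  exact ⟨R, hR⟩

lemma exists_isProper_of_isInjectiveCogeneratorFor [W.ContainsZero] [W.IsClosedUnderIsomorphisms]
    (hWX : W ≤ X) (hW : IsInjectiveCogeneratorFor W X) (hM : projDimLT X (n + 1) M) :
    ∃ R : Resolution X M, R.IsProper ∧ R.length ≤ n ∧ ∀ k, W (R.complex.X (k + 1)) := by
  obtain ⟨R, hT, hR⟩ := exists_resolution (V := X)
    (fun | 0 => projDimLT X (n + 1) | k + 1 => projDimLT W (n - k))
    (fun | 0 => X | k + 1 => fun A => W A ∧ (n - k = 0 → IsZero A))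
    (fun | 0 => le_rfl | _ + 1 => fun A hA => hWX A hA.1)
    (fun k => perp_projDimLT hW.perp (n - k))
    (fun
      | 0 => fun K hK => exists_approximation_of_projDimLT hW.cogenerator hK
      | k + 1 => fun K hK => exists_shortExact_of_projDimLT hK) hM
  refine ⟨R, hR, (length_le_iff R n).2 fun k hk => ?_, fun k => (hT (k + 1)).1⟩
  cases k with
  | zero => lia
  | succ k => exact (hT (k + 1)).2 (by lia)

end SpecialResolutions

section RelativeExt

variable {X : ObjectProperty C} {M : C}

lemma isZero_relExt {P : Resolution X M} {n : ℕ} (h : IsZero (P.complex.X n)) (N : C) :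
    IsZero ((relExt P n).obj N) := by
  have : Subsingleton (P.complex.X n ⟶ N) := ⟨h.eq_of_src⟩
  exact ShortComplex.isZero_homology_of_isZero_X₂ _
    (AddCommGrpCat.isZero_of_subsingleton (.of (P.complex.X n ⟶ N)))

end RelativeExt

section MappingCone

open HomologicalComplex HomologicalComplex.homotopyCofiber

section

variable {ι : Type*} {c : ComplexShape ι} [DecidableRel c.Rel] {F G : HomologicalComplex C c}
  {φ : F ⟶ G} {h i j : ι}

lemma exactAt_homotopyCofiber (hhi : c.Rel h i) (hij : c.Rel i j)
    (hj : Mono (homologyMap φ j)) (hi : Epi (homologyMap φ i)) :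
    (homotopyCofiber φ).ExactAt i := by
  rw [mono_homologyMap_iff_up_to_refinements φ i j _ (c.prev_eq' hij) rfl] at hj
  rw [epi_homologyMap_iff_up_to_refinements φ h i j (c.prev_eq' hhi) (c.next_eq' hij)] at hi
  rw [exactAt_iff_exact_up_to_refinements _ h i j (c.prev_eq' hhi) (c.next_eq' hij)]
  intro A x (hx : x ≫ d φ i j = 0)
  set p := x ≫ fstX φ i j hij with hp
  set q := x ≫ sndX φ i with hq
  have hpd : p ≫ F.d j (c.next j) = 0 := by
    by_cases hjk : c.Rel j (c.next j)
    · simpa [d_fstX φ i j _ hij hjk, p] using hx =≫ fstX φ j _ hjk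
    · rw [F.shape _ _ hjk, comp_zero]
  have hpq : p ≫ φ.f j + q ≫ G.d i j = 0 := by
    simpa [d_sndX φ i j hij, p, q] using hx =≫ sndX φ j
  obtain ⟨A₁, π₁, _, a, ha⟩ := hj p hpd (-q) (by rwa [Preadditive.neg_comp, eq_neg_iff_add_eq_zero])
  obtain ⟨A₂, π₂, _, z, hz, b, hb⟩ := hi (π₁ ≫ q + a ≫ φ.f i) (by
    rw [Preadditive.add_comp, Category.assoc π₁, Category.assoc a, φ.comm, ← reassoc_of% ha,
      ← Preadditive.comp_add, add_comm, hpq, comp_zero])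
  refine ⟨A₂, π₂ ≫ π₁, inferInstance,
    (z - π₂ ≫ a) ≫ inlX φ i h hhi + b ≫ inrX φ h, ext_to_X φ i j hij ?_ ?_⟩
  · simp [d_fstX φ h i j hhi hij, hz, ← ha, ← hp]
  · rw [Preadditive.comp_add, ← sub_eq_iff_eq_add'] at hb
    simp [d_sndX φ h i hhi, ← hb, ← hq]

lemma exactAt_homotopyCofiber_of_not_rel (hhi : c.Rel h i) (hi' : ¬ c.Rel i (c.next i))
    (hi : Epi (homologyMap φ i)) : (homotopyCofiber φ).ExactAt i := by
  rw [epi_homologyMap_iff_up_to_refinements φ h i _ (c.prev_eq' hhi) rfl] at hi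
  rw [exactAt_iff_exact_up_to_refinements _ h i _ (c.prev_eq' hhi) rfl]
  intro A x _
  obtain ⟨A', π, _, z, -, b, hb⟩ := hi (x ≫ sndX φ i) (by rw [G.shape _ _ hi', comp_zero])
  refine ⟨A', π, inferInstance, z ≫ inlX φ i h hhi + b ≫ inrX φ h, ext_to_X' φ i hi' ?_⟩
  simp [d_sndX φ h i hhi, hb]

end

variable {W X : ObjectProperty C} {M : C}

/-- The augmentation of a resolution as a morphism of complexes to `M` concentrated in
degree `0`. -/
noncomputable def toSingle (R : Resolution X M) : R.complex ⟶ (ChainComplex.single₀ C).obj M :=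
  (ChainComplex.toSingle₀Equiv _ _).symm ⟨R.ε, R.w⟩

lemma quasiIso_toSingle (R : Resolution X M) : QuasiIso (toSingle R) := by
  have hR := acyclic_iff.1 R.exact
  refine ⟨fun n => ?_⟩
  cases n with
  | zero =>
    rw [ChainComplex.quasiIsoAt₀_iff, ShortComplex.quasiIso_iff_of_zeros' _
      (R.complex.shape _ _ (by simp)) rfl rfl]
    refine (ShortComplex.exact_and_epi_g_iff_of_iso ?_).2 ⟨hR.2 0, hR.1⟩
    exact ShortComplex.isoMk (Iso.refl _) (Iso.refl _) (Iso.refl _)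
      ((Category.id_comp _).trans (Category.comp_id _).symm)
      ((Category.id_comp R.ε).trans ((Category.comp_id _).trans
        (ChainComplex.toSingle₀Equiv_symm_apply_f_zero R.ε R.w)).symm)
  | succ n =>
    rw [quasiIsoAt_iff_exactAt' _ _ (ChainComplex.exactAt_succ_single_obj M n),
      R.complex.exactAt_iff' (n + 2) (n + 1) n (by simp) (by simp)]
    exact hR.2 (n + 1)

lemma quasiIso_hom {Q : Resolution W M} {P : Resolution X M} (φ : Lift Q P) :
    QuasiIso φ.hom := by
  have := quasiIso_toSingle P
  have h : φ.hom ≫ toSingle P = toSingle Q := by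
    apply (ChainComplex.toSingle₀Equiv _ _).injective
    ext
    simp [toSingle, φ.comm]
  have : QuasiIso (φ.hom ≫ toSingle P) := h ▸ quasiIso_toSingle Q
  exact quasiIso_of_comp_right φ.hom (toSingle P)

lemma acyclic_homotopyCofiber {F G : ChainComplex C ℕ} (φ : F ⟶ G) [QuasiIso φ] :
    (homotopyCofiber φ).Acyclic := by
  rintro (_ | n)
  · exact exactAt_homotopyCofiber_of_not_rel (h := 1) (by simp) (by simp) inferInstance
  · exact exactAt_homotopyCofiber (h := n + 2) (by simp) (j := n) (by simp) inferInstance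
      inferInstance

end MappingCone

section MappingConeHom

open HomologicalComplex HomologicalComplex.homotopyCofiber

lemma exists_d_eq_and_add_eq {ι : Type*} {c : ComplexShape ι}
    {F G : HomologicalComplex AddCommGrpCat c} {φ : F ⟶ G} {h i j k : ι}
    (hhi : c.Rel h i) (hij : c.Rel i j) (hjk : c.Rel j k)
    (hj : Mono (homologyMap φ j)) (hi : Epi (homologyMap φ i)) (p : F.X j) (q : G.X i)
    (hp : F.d j k p = 0) (hpq : φ.f j p = G.d i j q) :
    ∃ (l : F.X i) (r : G.X h), F.d i j l = p ∧ φ.f i l + G.d h i r = q := by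
  classical
  -- `(-p, q)` is a cycle of the mapping cone of `φ`, and `(l, r)` is an element bounding it.
  have hφ := exactAt_homotopyCofiber hhi hij hj hi
  rw [exactAt_iff' _ h i j (c.prev_eq' hhi) (c.next_eq' hij), ShortComplex.ab_exact_iff] at hφ
  have hd : d φ i j (inrX φ i q - inlX φ j i hij p) = 0 := by
    have h₁ : d φ i j (inlX φ j i hij p) = -inlX φ k j hjk (F.d j k p) + inrX φ j (φ.f j p) :=
      ConcreteCategory.congr_hom (inlX_d φ i j k hij hjk) p
    have h₂ : d φ i j (inrX φ i q) = inrX φ j (G.d i j q) :=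
      ConcreteCategory.congr_hom (inrX_d φ i j) q
    rw [map_sub, h₁, h₂, hp, hpq, map_zero, neg_zero, zero_add, sub_self]
  obtain ⟨x, hx⟩ : ∃ x : (homotopyCofiber.X φ h : AddCommGrpCat),
      d φ h i x = inrX φ i q - inlX φ j i hij p := hφ _ hd
  refine ⟨fstX φ h i hhi x, sndX φ h x, ?_, ?_⟩
  · have h₁ : fstX φ i j hij (d φ h i x) = -F.d i j (fstX φ h i hhi x) :=
      ConcreteCategory.congr_hom (d_fstX φ h i j hhi hij) x
    have h₂ : fstX φ i j hij (inlX φ j i hij p) = p :=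
      ConcreteCategory.congr_hom (inlX_fstX φ j i hij) p
    have h₃ : fstX φ i j hij (inrX φ i q) = 0 :=
      ConcreteCategory.congr_hom (inrX_fstX φ i j hij) q
    rwa [hx, map_sub, h₂, h₃, zero_sub, neg_inj, eq_comm] at h₁
  · have h₁ : sndX φ i (d φ h i x) = φ.f i (fstX φ h i hhi x) + G.d h i (sndX φ h x) :=
      ConcreteCategory.congr_hom (d_sndX φ h i hhi) x
    have h₂ : sndX φ i (inlX φ j i hij p) = 0 :=
      ConcreteCategory.congr_hom (inlX_sndX φ j i hij) p
    have h₃ : sndX φ i (inrX φ i q) = q := ConcreteCategory.congr_hom (inrX_sndX φ i) q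
    rwa [hx, map_sub, h₂, h₃, sub_zero, eq_comm] at h₁

lemma exists_d_comp_eq {Q P : ChainComplex C ℕ} {φ : Q ⟶ P} {N : C} {m : ℕ}
    (h : Epi (homologyMap ((homComplexMap φ).app N) (m + 1)))
    (h' : Mono (homologyMap ((homComplexMap φ).app N) (m + 2)))
    (f : (homotopyCofiber φ).X (m + 2) ⟶ N)
    (hf : (homotopyCofiber φ).d (m + 3) (m + 2) ≫ f = 0) :
    ∃ g, (homotopyCofiber φ).d (m + 2) (m + 1) ≫ g = f := by
  -- Up to a shift and signs, `Hom(cone φ, N)` is the mapping cone of `Hom(φ, N)`.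
  have hm (n : ℕ) : (ComplexShape.down ℕ).Rel (n + 1) n := rfl
  replace hf : d φ (m + 3) (m + 2) ≫ f = 0 := hf
  have hp := (inrX_d_assoc φ (m + 3) (m + 2) f).symm.trans (by rw [hf, comp_zero])
  have hpq := (inlX_d_assoc φ (m + 3) (m + 2) (m + 1) (hm _) (hm _) f).symm.trans
    (by rw [hf, comp_zero])
  rw [Preadditive.add_comp, Preadditive.neg_comp, neg_add_eq_zero, Category.assoc, Category.assoc]
    at hpq
  obtain ⟨(l : P.X (m + 1) ⟶ N), (r : Q.X m ⟶ N),
      (hl : P.d (m + 2) (m + 1) ≫ l = inrX φ (m + 2) ≫ f),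
      (hr : φ.f (m + 1) ≫ l + Q.d (m + 1) m ≫ r = inlX φ (m + 1) (m + 2) (hm _) ≫ f)⟩ :=
    exists_d_eq_and_add_eq (h := m) (k := m + 3) rfl rfl rfl h' h
      (inrX φ (m + 2) ≫ f) (inlX φ (m + 1) (m + 2) (hm _) ≫ f) hp hpq.symm
  let g : homotopyCofiber.X φ (m + 1) ⟶ N := sndX φ (m + 1) ≫ l - fstX φ (m + 1) m (hm _) ≫ r
  have h₁ : inlX φ m (m + 1) (hm _) ≫ g = -r := by
    rw [Preadditive.comp_sub, inlX_sndX_assoc, inlX_fstX_assoc, zero_comp, zero_sub]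
  have h₂ : inrX φ (m + 1) ≫ g = l := by
    rw [Preadditive.comp_sub, inrX_sndX_assoc, inrX_fstX_assoc, zero_comp, sub_zero]
  refine ⟨g, ext_from_X φ (m + 1) (m + 2) (hm _) ?_ ?_⟩
  · calc inlX φ (m + 1) (m + 2) (hm _) ≫ d φ (m + 2) (m + 1) ≫ g
        = -(Q.d (m + 1) m ≫ inlX φ m (m + 1) (hm _) ≫ g) + φ.f (m + 1) ≫ inrX φ (m + 1) ≫ g := by
          simp [inlX_d_assoc φ (m + 2) (m + 1) m (hm _) (hm _)]
      _ = inlX φ (m + 1) (m + 2) (hm _) ≫ f := by rw [h₁, h₂, ← hr]; simp [add_comm]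
  · exact (inrX_d_assoc φ (m + 2) (m + 1) g).trans (by rw [h₂, hl])

end MappingConeHom

section Descent

variable {W X : ObjectProperty C} {E : ChainComplex C ℕ}

lemma prop_cycles [X.IsClosedUnderIsomorphisms] (hXker : ClosedUnderKernelsOfEpis X)
    (hE : E.Acyclic) (hX : ∀ n, X (E.X n)) (n : ℕ) : X (E.cycles n) := by
  induction n with
  | zero => exact X.prop_of_iso (cyclesZeroIso E).symm (hX 0)
  | succ n ih => exact hXker _ (shortExact_cycles hE n) (hX (n + 1)) ih

lemma prop_cycles_of_retraction [W.IsStableUnderRetracts] (hE : E.Acyclic) {n : ℕ}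
    (hW : W (E.X (n + 1))) (r : E.X (n + 1) ⟶ E.cycles (n + 1))
    (hr : E.d (n + 2) (n + 1) ≫ r = E.toCycles (n + 2) (n + 1)) : W (E.cycles (n + 1)) := by
  have := (shortExact_cycles hE (n + 1)).epi_g
  refine W.prop_of_retract ⟨E.iCycles (n + 1), r, ?_⟩ hW
  rw [← cancel_epi (E.toCycles (n + 2) (n + 1)), E.toCycles_i_assoc, hr, Category.comp_id]

lemma prop_cycles_of_prop_cycles_succ [W.IsStableUnderRetracts] (hXW : Perp X W)
    (hE : E.Acyclic) {n : ℕ} (hX : X (E.cycles n)) (hW : W (E.X (n + 1)))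
    (h : W (E.cycles (n + 1))) : W (E.cycles n) := by
  obtain ⟨s, hs⟩ := exists_lift_of_perp hXW (shortExact_cycles hE n) h hX (𝟙 _)
  exact W.prop_of_retract ⟨s, E.toCycles (n + 1) n, hs⟩ hW

lemma prop_X_zero_of_retraction [W.IsStableUnderRetracts] [X.IsClosedUnderIsomorphisms]
    (hXker : ClosedUnderKernelsOfEpis X) (hXW : Perp X W) (hE : E.Acyclic)
    (hX : ∀ n, X (E.X n)) (hW : ∀ n, W (E.X (n + 1))) {m : ℕ}
    (r : E.X (m + 1) ⟶ E.cycles (m + 1))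
    (hr : E.d (m + 2) (m + 1) ≫ r = E.toCycles (m + 2) (m + 1)) : W (E.X 0) := by
  have h (k : ℕ) (hk : k ≤ m + 1) : W (E.cycles k) := by
    induction hk using Nat.decreasingInduction with
    | self => exact prop_cycles_of_retraction hE (hW m) r hr
    | of_succ k _ ih =>
      exact prop_cycles_of_prop_cycles_succ hXW hE (prop_cycles hXker hE hX k) (hW k) ih
  exact W.prop_of_iso (cyclesZeroIso E) (h 0 (Nat.zero_le _))

end Descent

section Comparison

open HomologicalComplex HomologicalComplex.homotopyCofiber

variable {W X : ObjectProperty C} {M : C}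

lemma isIso_comparison_of_projDim_lt_top (hW : IsSubcategory W) (hXW : Perp X W)
    (hM : projDim W M < ⊤) {P : Resolution X M} {Q : Resolution W M} (hP : P.IsProper)
    (hQ : Q.IsProper) (φ : Lift Q P) (i : ℕ) : IsIso (comparison φ i) := by
  have := hW.isoClosed
  have := hW.zero
  obtain ⟨m, hm⟩ := ENat.ne_top_iff_exists.1 hM.ne
  obtain ⟨R, hR⟩ := exists_isProperFor_of_projDimLT hXW (projDimLT_of_projDim_le hm.ge)
  obtain ⟨α⟩ := nonempty_lift P hR
  obtain ⟨β⟩ := nonempty_lift R hQ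
  exact isIso_comparison hQ hP φ (compLift α β) i

lemma prop_X_zero_of_comparison [X.IsClosedUnderIsomorphisms] (hXker : ClosedUnderKernelsOfEpis X)
    (hW : IsSubcategory W) (hWX : W ≤ X) (hWsum : ClosedUnderSummands W) (hXW : Perp X W)
    {P : Resolution X M} {Q : Resolution W M} (hP : ∀ n, W (P.complex.X (n + 1)))
    (φ : Lift Q P) {m : ℕ} (h : ∀ N, Epi ((comparison φ (m + 1)).app N))
    (h' : ∀ N, Mono ((comparison φ (m + 2)).app N)) : W (P.complex.X 0) := by
  have := hW.isoClosed
  have : W.IsStableUnderRetracts := hWsum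
  have := quasiIso_hom φ
  let E := homotopyCofiber φ.hom
  have hE : E.Acyclic := acyclic_homotopyCofiber φ.hom
  have hE₀ : E.X 0 ≅ P.complex.X 0 := XIso φ.hom 0 (by simp)
  have hEW (n : ℕ) : W (E.X (n + 1)) :=
    W.prop_of_iso (XIsoBiprod φ.hom (n + 1) n rfl).symm (hW.biprod _ _ (Q.mem n) (hP n))
  have hEX (n : ℕ) : X (E.X n) := by
    cases n with
    | zero => exact X.prop_of_iso hE₀.symm (P.mem 0)
    | succ n => exact hWX _ (hEW n)
  obtain ⟨r, hr⟩ := exists_d_comp_eq (h (E.cycles (m + 1))) (h' (E.cycles (m + 1)))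
    (E.toCycles (m + 2) (m + 1)) (E.d_toCycles _ _ _)
  exact W.prop_of_iso hE₀ (prop_X_zero_of_retraction hXker hXW hE hEX hEW r hr)

lemma projDim_lt_top_of_comparison [X.IsClosedUnderIsomorphisms]
    (hXker : ClosedUnderKernelsOfEpis X) (hW : IsSubcategory W) (hWX : W ≤ X)
    (hWsum : ClosedUnderSummands W) (hXW : Perp X W) {P : Resolution X M} {Q : Resolution W M}
    (hP : ∀ n, W (P.complex.X (n + 1))) {d : ℕ} (hd : P.length ≤ d) (φ : Lift Q P) {m : ℕ}
    (h : IsIso (comparison φ (m + 1))) (h' : IsIso (comparison φ (m + 2)) ∨ d ≤ m + 1) :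
    projDim W M < ⊤ := by
  have h₂ (N : C) : Mono ((comparison φ (m + 2)).app N) := by
    obtain h' | h' := h'
    · infer_instance
    · exact (isZero_relExt ((length_le_iff P d).1 hd _ (by lia)) N).mono _
  have hP₀ : W (P.complex.X 0) :=
    prop_X_zero_of_comparison hXker hW hWX hWsum hXW hP φ (fun _ => inferInstance) h₂
  let R : Resolution W M :=
    { complex := P.complex
      mem := fun | 0 => hP₀ | n + 1 => hP n
      ε := P.ε
      w := P.w
      exact := P.exact }
  exact projDim_lt_top R hd

lemma exists_lift_isIso_comparison {P P' : Resolution X M} {Q : Resolution W M} (hP : P.IsProper)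
    (hP' : P'.IsProper) (φ : Lift Q P) :
    ∃ φ' : Lift Q P', ∀ i, IsIso (comparison φ i) → IsIso (comparison φ' i) := by
  obtain ⟨α⟩ := nonempty_lift P hP'
  obtain ⟨β⟩ := nonempty_lift P' hP
  refine ⟨compLift φ α, fun i _ => ?_⟩
  have := isIso_comparison hP hP' α β i
  rw [comparison_comp]
  infer_instance

end Comparison

end RelativeHomology

open RelHom RelativeHomology in
theorem corollary5p6_general {C : Type u} [Category.{v} C] [Abelian C] {X W : ObjectProperty C}
    (hXsub : IsSubcategory X) (hWsub : IsSubcategory W) (hWX : W ≤ X)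
    (hXext : X.IsClosedUnderExtensions) (hXker : ClosedUnderKernelsOfEpis X)
    (hWsum : ClosedUnderSummands W) (hWinj : IsInjectiveCogeneratorFor W X)
    (hWproj : IsProjectiveGeneratorFor W X) {M : C} {d : ℕ} (hd : projDim X M ≤ d) :
    (∃ P : Resolution X M, P.IsProper) ∧ (∃ Q : Resolution W M, Q.IsProper) ∧
    ∀ (P : Resolution X M) (Q : Resolution W M), P.IsProper → Q.IsProper →
      Nonempty (Lift Q P) ∧
      ∀ φ : Lift Q P,
        List.TFAE
          [projDim W M < ⊤,
           ∀ i : ℕ, IsIso (comparison φ i),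
           (∃ i : ℕ, 1 ≤ i ∧ i + 1 < d ∧ IsIso (comparison φ i) ∧ IsIso (comparison φ (i + 1))) ∨
            (∃ i : ℕ, 1 ≤ i ∧ d ≤ i ∧ IsIso (comparison φ i))] := by
  have := hXsub.isoClosed
  have := hXsub.zero
  have := hWsub.isoClosed
  have := hWsub.zero
  have hM := projDimLT_of_projDim_le hd
  obtain ⟨P', hP', hP'd, hP'W⟩ := exists_isProper_of_isInjectiveCogeneratorFor hWX hWinj hM
  refine ⟨⟨P', hP'⟩, exists_isProper_of_isProjectiveGeneratorFor hWproj hM, fun P Q hP hQ =>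
    ⟨nonempty_lift Q fun A hA => hP A (hWX A hA), fun φ => ?_⟩⟩
  tfae_have 1 → 2 := fun h => isIso_comparison_of_projDim_lt_top hWsub hWinj.perp h hP hQ φ
  tfae_have 2 → 3 := fun h => Or.inr ⟨d + 1, by lia, by lia, h _⟩
  tfae_have 3 → 1 := by
    intro h
    obtain ⟨φ', hφ'⟩ := exists_lift_isIso_comparison hP hP' φ
    obtain ⟨m, hm, hm'⟩ : ∃ m, IsIso (comparison φ (m + 1)) ∧
        (IsIso (comparison φ (m + 2)) ∨ d ≤ m + 1) := by
      obtain ⟨_ | m, h₁, -, h, h'⟩ | ⟨_ | m, h₁, h₂, h⟩ := h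
      exacts [by lia, ⟨m, h, .inl h'⟩, by lia, ⟨m, h, .inr h₂⟩]
    exact projDim_lt_top_of_comparison hXker hWsub hWX hWsum hWinj.perp hP'W hP'd φ'
      (hφ' _ hm) (hm'.imp_left (hφ' _))
  tfae_finish

theorem corollary5p6 {C : Type u} [Category.{v} C] [Abelian C]
    (X W : ObjectProperty C)
    (hXsub : RelHom.IsSubcategory X) (hWsub : RelHom.IsSubcategory W) (hWX : W ≤ X)
    (hXexact : RelHom.IsExactSubcategory X)
    (hXker : RelHom.ClosedUnderKernelsOfEpis X)
    (hWsum : RelHom.ClosedUnderSummands W)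
    (hWker : RelHom.ClosedUnderKernelsOfEpis W)
    (hWinj : RelHom.IsInjectiveCogeneratorFor W X)
    (hWproj : RelHom.IsProjectiveGeneratorFor W X)
    (M : C) (d : ℕ) (hd : RelHom.projDim X M = (d : ℕ∞)) :
    -- proper resolutions of `M` exist, so the comparison transformations are defined
    (∃ P : RelHom.Resolution X M, P.IsProper) ∧
    (∃ Q : RelHom.Resolution W M, Q.IsProper) ∧
    ∀ (P : RelHom.Resolution X M) (Q : RelHom.Resolution W M), P.IsProper → Q.IsProper →
      Nonempty (RelHom.Lift Q P) ∧
      ∀ φ : RelHom.Lift Q P,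
        List.TFAE
          [RelHom.projDim W M < ⊤,
           ∀ i : ℕ, IsIso (RelHom.comparison φ i),
           (∃ i : ℕ, 1 ≤ i ∧ i + 1 < d ∧
              IsIso (RelHom.comparison φ i) ∧ IsIso (RelHom.comparison φ (i + 1))) ∨
            (∃ i : ℕ, 1 ≤ i ∧ d ≤ i ∧ IsIso (RelHom.comparison φ i))] :=
  corollary5p6_general hXsub hWsub hWX hXexact.extensions hXker hWsum hWinj hWproj hd.le
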